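/- Let $p$ be an odd prime. Then $$\sum_{k=0}^{[p/4]}\binom{4k}{2k}\frac1{32^k}\equiv\begin{cases}1\pmod p&\text{if }p\equiv\pm1,\pm3\pmod{16},\\-1\pmod p&\text{if }p\equiv\pm5,\pm7\pmod{16}.\end{cases}$$ Here $[x]$ is the greatest integer not exceeding $x$. For rational numbers $a,b$ whose denominators are not divisible by $p$, $a\equiv b\pmod p$ means that $a-b=pz$ for some rational number $z$ whose denominator is not divisible by $p$. -/

import Mathlib

/-- The set of those rational numbers whose (reduced) denominator is not divisible by `p`. -/
def PIntegral (p : ℕ) : Set ℚ := {x | ¬ p ∣ x.den}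

/-- Congruence `a ≡ b (mod p)` between rational numbers that are integral at `p`:
`a - b` is `p` times a rational number that is integral at `p`. -/
def RatModEq (p : ℕ) (a b : ℚ) : Prop :=
  a ∈ PIntegral p ∧ b ∈ PIntegral p ∧ ∃ z ∈ PIntegral p, a - b = (p : ℚ) * z

/-! Write `p = 2n + 1`. Modulo `p`, `C(2j, j) = (-4)^j C(n, j)` for `j ≤ n`, so with `j = 2k` the
sum becomes `∑ C(n, 2k) / 2^k`, which is half of `(1 + s)^n + (1 - s)^n` with `s = 1/√2`. For a
primitive 16th root of unity `x` with inverse `y`, `2(1 + s) = (x + y)^2` and `2(1 - s) = (x^3 +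
y^3)^2`. The Frobenius map then evaluates these powers through `x^p + y^p` and `x^(3p) + y^(3p)`,
which depend only on `p` mod 16. -/

theorem sum_range_two_mul {M : Type*} [AddCommMonoid M] (f : ℕ → M) (m : ℕ) :
    ∑ j ∈ Finset.range (2 * m), f j = ∑ k ∈ Finset.range m, (f (2 * k) + f (2 * k + 1)) := by
  induction m with
  | zero => simp
  | succ m ih =>
    rw [Finset.sum_range_succ, ← ih, show 2 * (m + 1) = 2 * m + 1 + 1 by ring,
      Finset.sum_range_succ, Finset.sum_range_succ, add_assoc]

theorem one_add_pow_add_one_sub_pow {R : Type*} [CommRing R] (s : R) (n : ℕ) :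
    (1 + s) ^ n + (1 - s) ^ n =
      2 * ∑ k ∈ Finset.range (n / 2 + 1), (n.choose (2 * k) : R) * (s ^ 2) ^ k := by
  have expand (r : R) : (1 + r) ^ n =
      ∑ j ∈ Finset.range (2 * (n / 2 + 1)), (n.choose j : R) * r ^ j := by
    rw [add_comm, add_pow]
    rw [← Finset.sum_subset (Finset.range_subset_range.2 (show n + 1 ≤ 2 * (n / 2 + 1) by omega))]
    · exact Finset.sum_congr rfl fun j _ => by rw [one_pow, mul_one, mul_comm]
    · intro j _ hj
      rw [Nat.choose_eq_zero_of_lt (by simpa using hj)]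
      simp
  rw [sub_eq_add_neg, expand, expand, sum_range_two_mul, sum_range_two_mul,
    ← Finset.sum_add_distrib, Finset.mul_sum]
  refine Finset.sum_congr rfl fun k _ => ?_
  rw [pow_succ (-s), pow_succ s, pow_mul (-s), pow_mul s, neg_sq]
  ring

/-- Both sides satisfy `(j + 1) a_(j+1) = 2 (2j + 1) a_j`, because `2n = -1` in `K`; and `j + 1 ≤ n
< p` is invertible. -/
theorem centralBinom_eq_neg_four_pow_mul_choose {K : Type*} [Field K] {p n : ℕ} [CharP K p]
    (hn : p = 2 * n + 1) {j : ℕ} (hj : j ≤ n) :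
    (j.centralBinom : K) = (-4) ^ j * (n.choose j : K) := by
  induction j with
  | zero => simp
  | succ j ih =>
    have hne : ((j + 1 : ℕ) : K) ≠ 0 := by
      rw [Ne, CharP.cast_eq_zero_iff K p]
      exact Nat.not_dvd_of_pos_of_lt (by omega) (by omega)
    have h1 := congrArg (Nat.cast (R := K)) (Nat.succ_mul_centralBinom_succ j)
    have h2 := congrArg (Nat.cast (R := K)) (Nat.choose_succ_right_eq n j)
    have hp : (2 * n + 1 : K) = 0 := by
      have := CharP.cast_eq_zero K p
      rw [hn] at this
      exact_mod_cast this
    rw [Nat.cast_mul, Nat.cast_mul, Nat.cast_sub (by omega)] at h2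
    rw [Nat.cast_mul, Nat.cast_mul, ih (by omega)] at h1
    apply mul_left_cancel₀ hne
    rw [h1, pow_succ]
    push_cast at h2 ⊢
    linear_combination 4 * (-4) ^ j * h2 + 2 * (-4) ^ j * (n.choose j : K) * hp

theorem sq_add_sq_sq_eq_two {R : Type*} [CommRing R] {x y : R} (hx : x ^ 8 = -1)
    (hxy : x * y = 1) : (x ^ 2 + y ^ 2) ^ 2 = 2 := by
  grind

/-- The value of `(1 + 1/√2) ^ n + (1 - 1/√2) ^ n` in characteristic `p = 2 * n + 1`, where
`√2 = x ^ 2 + x⁻¹ ^ 2` for a primitive sixteenth root of unity `x`. -/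
theorem one_add_pow_add_one_sub_pow_of_pow_eight {K : Type*} [Field K] {p n : ℕ} [Fact p.Prime]
    [CharP K p] (hn : p = 2 * n + 1) (h2 : (2 : K) ≠ 0) {x y s : K} (hx : x ^ 8 = -1)
    (hxy : x * y = 1) (hs : 2 * s = x ^ 2 + y ^ 2) :
    ((p % 16 = 1 ∨ p % 16 = 3 ∨ p % 16 = 13 ∨ p % 16 = 15) →
      (1 + s) ^ n + (1 - s) ^ n = 2) ∧
    ((p % 16 = 5 ∨ p % 16 = 7 ∨ p % 16 = 9 ∨ p % 16 = 11) →
      (1 + s) ^ n + (1 - s) ^ n = -2) := by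
  have hy : y = -x ^ 7 := by linear_combination y * hx - x ^ 7 * hxy
  have hy8 : y ^ 8 = -1 := by
    have : (x * y) ^ 8 = 1 := by rw [hxy, one_pow]
    rw [mul_pow, hx] at this
    linear_combination -this
  have hxp : x ^ p = x ^ (p % 16) := pow_eq_pow_mod p (by linear_combination (x ^ 8 - 1) * hx)
  have hyp : y ^ p = y ^ (p % 16) := pow_eq_pow_mod p (by linear_combination (y ^ 8 - 1) * hy8)
  -- The `n`-th power of `h`, times `a + b`, is `(a + b)^p`.
  have frob (a b c : K) (h : (a + b) ^ 2 = 2 * c) :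
      (a + b) * (2 ^ n * c ^ n) = a ^ p + b ^ p := by
    rw [← add_pow_char, ← mul_pow, ← h, ← pow_mul, hn]
    ring
  have hx3 : x ^ 6 = -y ^ 2 := by subst hy; clear * - hx; grind
  have hy3 : y ^ 6 = -x ^ 2 := by subst hy; clear * - hx; grind
  have ht2 := sq_add_sq_sq_eq_two hx hxy
  have e1 := frob x y (1 + s) (by linear_combination 2 * hxy - hs)
  have e3 := frob (x ^ 3) (y ^ 3) (1 - s) (by
    linear_combination hx3 + hy3 + hs + 2 * ((x * y) ^ 2 + x * y + 1) * hxy)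
  have e2 := frob (x ^ 2) (y ^ 2) 1 (by rw [ht2, mul_one])
  rw [pow_right_comm x, pow_right_comm y, hxp, hyp] at e3 e2
  rw [hxp, hyp] at e1
  rw [one_pow, mul_one] at e2
  have ht : x ^ 2 + y ^ 2 ≠ 0 := fun h => h2 (by rw [← ht2, h]; ring)
  have ha13 : (x + y) * (x ^ 3 + y ^ 3) = x ^ 2 + y ^ 2 := by subst hy; clear * - hx; grind
  have ha1 : x + y ≠ 0 := fun h => ht (by rw [← ha13, h]; ring)
  have ha3 : x ^ 3 + y ^ 3 ≠ 0 := fun h => ht (by rw [← ha13, h]; ring)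
  have hsq : (x + y) ^ 2 - (x ^ 3 + y ^ 3) ^ 2 = 2 * (x ^ 2 + y ^ 2) := by subst hy; clear * - hx; grind
  generalize (1 + s) ^ n = u at *
  generalize (1 - s) ^ n = v at *
  generalize (2 : K) ^ n = w at *
  -- The two families of residues where `2` is a square, resp. is not a square.
  have square (ε : K) (h1 : (x + y) * (w * u) = ε * (x + y))
      (h3 : (x ^ 3 + y ^ 3) * (w * v) = ε * (x ^ 3 + y ^ 3))
      (ht' : (x ^ 2 + y ^ 2) * w = x ^ 2 + y ^ 2) : u + v = 2 * ε := by
    have hw : w = 1 := mul_left_cancel₀ ht (by rw [ht', mul_one])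
    subst hw
    have hu : u = ε := mul_left_cancel₀ ha1 (by linear_combination h1)
    have hv : v = ε := mul_left_cancel₀ ha3 (by linear_combination h3)
    rw [hu, hv]; ring
  have nonsquare (ε : K) (h1 : (x + y) * (w * u) = ε * (x ^ 3 + y ^ 3))
      (h3 : (x ^ 3 + y ^ 3) * (w * v) = -ε * (x + y))
      (ht' : (x ^ 2 + y ^ 2) * w = -(x ^ 2 + y ^ 2)) : u + v = 2 * ε := by
    have hw : w = -1 := mul_left_cancel₀ ht (by rw [ht', mul_neg, mul_one])
    subst hw
    -- With `A = x + y` and `B = x^3 + y^3`, `u = -ε B/A` and `v = ε A/B`, so `u + v = ε (A^2 -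
    -- B^2)/(AB)`, where `A^2 - B^2 = 2AB`.
    apply mul_left_cancel₀ (mul_ne_zero ha1 ha3)
    linear_combination -(x ^ 3 + y ^ 3) * h1 - (x + y) * h3 + ε * hsq - 2 * ε * ha13
  constructor
  · rw [← mul_one 2]
    rintro (h | h | h | h) <;> rw [h] at e1 e2 e3
    · refine square 1 (e1.trans ?_) (e3.trans ?_) (e2.trans ?_)
      all_goals subst hy; clear * - hx; grind
    · refine nonsquare 1 (e1.trans ?_) (e3.trans ?_) (e2.trans ?_)
      all_goals subst hy; clear * - hx; grind
    · refine nonsquare 1 (e1.trans ?_) (e3.trans ?_) (e2.trans ?_)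
      all_goals subst hy; clear * - hx; grind
    · refine square 1 (e1.trans ?_) (e3.trans ?_) (e2.trans ?_)
      all_goals subst hy; clear * - hx; grind
  · rw [← mul_neg_one]
    rintro (h | h | h | h) <;> rw [h] at e1 e2 e3
    · refine nonsquare (-1) (e1.trans ?_) (e3.trans ?_) (e2.trans ?_)
      all_goals subst hy; clear * - hx; grind
    · refine square (-1) (e1.trans ?_) (e3.trans ?_) (e2.trans ?_)
      all_goals subst hy; clear * - hx; grind
    · refine square (-1) (e1.trans ?_) (e3.trans ?_) (e2.trans ?_)
      all_goals subst hy; clear * - hx; grind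
    · refine nonsquare (-1) (e1.trans ?_) (e3.trans ?_) (e2.trans ?_)
      all_goals subst hy; clear * - hx; grind

/-- Scaling by `32^(n/2)` makes every term an integer, so the sum can be read both in `ℚ` and in
`K`. -/
theorem sum_choose_four_mul_eq {K : Type*} [Field K] {p n : ℕ} [CharP K p]
    (hn : p = 2 * n + 1) {s : K} (hs : 2 * s ^ 2 = 1) :
    2 * ∑ k ∈ Finset.range (n / 2 + 1), ((4 * k).choose (2 * k) : K) * 32 ^ (n / 2 - k) =
      32 ^ (n / 2) * ((1 + s) ^ n + (1 - s) ^ n) := by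
  rw [one_add_pow_add_one_sub_pow, mul_left_comm]
  congr 1
  rw [Finset.mul_sum]
  refine Finset.sum_congr rfl fun k hk => ?_
  have hk' : k ≤ n / 2 := by simpa [Nat.lt_succ_iff] using hk
  have hc := centralBinom_eq_neg_four_pow_mul_choose (K := K) hn (show 2 * k ≤ n by omega)
  rw [Nat.centralBinom_eq_two_mul_choose, show 2 * (2 * k) = 4 * k by ring, pow_mul] at hc
  have hpow : (32 : K) ^ k * (s ^ 2) ^ k = ((-4) ^ 2) ^ k := by
    rw [← mul_pow]; congr 1; linear_combination 16 * hs
  have h32 : (32 : K) ^ (n / 2) = 32 ^ (n / 2 - k) * 32 ^ k := by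
    rw [← pow_add, Nat.sub_add_cancel hk']
  rw [hc, h32, ← hpow]
  ring

theorem ratModEq_div_of_dvd {p : ℕ} (hp : p.Prime) {a c d : ℤ} (hd : ¬ (p : ℤ) ∣ d)
    (h : (p : ℤ) ∣ a - c * d) : RatModEq p (a / d : ℚ) c := by
  have integral (b : ℤ) : ((b : ℚ) / d) ∈ PIntegral p := fun hdvd =>
    hd ((Int.natCast_dvd_natCast.2 hdvd).trans (by simpa [Rat.divInt_eq_div] using Rat.den_dvd b d))
  have hd0 : (d : ℚ) ≠ 0 := by
    rintro h0
    exact hd (by rw [Int.cast_eq_zero.1 h0]; exact dvd_zero _)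
  obtain ⟨z, hz⟩ := h
  refine ⟨integral a, ?_, z / d, integral z, ?_⟩
  · simpa [PIntegral] using hp.ne_one
  · have : (a : ℚ) - c * d = p * z := by exact_mod_cast hz
    field_simp
    rwa [mul_comm (d : ℚ)]

theorem corollary2p3 (p : ℕ) (hp : p.Prime) (hodd : Odd p) :
    (((p : ℤ) ≡ 1 [ZMOD 16] ∨ (p : ℤ) ≡ -1 [ZMOD 16] ∨
        (p : ℤ) ≡ 3 [ZMOD 16] ∨ (p : ℤ) ≡ -3 [ZMOD 16]) →
      RatModEq p
        (∑ k ∈ Finset.range (p / 4 + 1), (Nat.choose (4 * k) (2 * k) : ℚ) * (1 / 32 ^ k)) 1) ∧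
    (((p : ℤ) ≡ 5 [ZMOD 16] ∨ (p : ℤ) ≡ -5 [ZMOD 16] ∨
        (p : ℤ) ≡ 7 [ZMOD 16] ∨ (p : ℤ) ≡ -7 [ZMOD 16]) →
      RatModEq p
        (∑ k ∈ Finset.range (p / 4 + 1), (Nat.choose (4 * k) (2 * k) : ℚ) * (1 / 32 ^ k)) (-1)) := by
  have : Fact p.Prime := ⟨hp⟩
  obtain ⟨n, hn⟩ := hodd
  -- An algebraically closed field supplies the root `x`; integers vanish in it exactly when `p`
  -- divides them.
  obtain ⟨K, _, _, _⟩ : ∃ (K : Type) (_ : Field K), IsAlgClosed K ∧ CharP K p :=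
    ⟨AlgebraicClosure (ZMod p), inferInstance, inferInstance, inferInstance⟩
  have h2 : (2 : K) ≠ 0 := by
    have hdvd : ¬ p ∣ 2 := fun h => by
      have := (Nat.prime_dvd_prime_iff_eq hp Nat.prime_two).1 h
      omega
    rw [← CharP.cast_eq_zero_iff K p] at hdvd
    exact_mod_cast hdvd
  obtain ⟨x, hx⟩ := IsAlgClosed.exists_pow_nat_eq (-1 : K) (show 0 < 8 by norm_num)
  have hx0 : x ≠ 0 := by rintro rfl; norm_num at hx
  have hxy : x * x⁻¹ = 1 := mul_inv_cancel₀ hx0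
  generalize x⁻¹ = y at hxy
  obtain ⟨s, hs⟩ : ∃ s : K, 2 * s = x ^ 2 + y ^ 2 := ⟨(x ^ 2 + y ^ 2) / 2, by field_simp⟩
  have hs2 : 2 * s ^ 2 = 1 := by
    apply mul_left_cancel₀ h2
    linear_combination sq_add_sq_sq_eq_two hx hxy + (2 * s + (x ^ 2 + y ^ 2)) * hs
  have key := sum_choose_four_mul_eq hn hs2
  obtain ⟨hpos, hneg⟩ := one_add_pow_add_one_sub_pow_of_pow_eight hn h2 hx hxy hs
  have hsum : ∑ k ∈ Finset.range (p / 4 + 1), (Nat.choose (4 * k) (2 * k) : ℚ) * (1 / 32 ^ k) =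
      ((∑ k ∈ Finset.range (n / 2 + 1), ((4 * k).choose (2 * k) : ℤ) * 32 ^ (n / 2 - k) : ℤ) : ℚ)
        / ((32 ^ (n / 2) : ℤ) : ℚ) := by
    rw [show p / 4 = n / 2 by omega]
    push_cast
    rw [Finset.sum_div]
    refine Finset.sum_congr rfl fun k hk => ?_
    have hk' : k ≤ n / 2 := by simpa [Nat.lt_succ_iff] using hk
    rw [show (32 : ℚ) ^ (n / 2) = 32 ^ (n / 2 - k) * 32 ^ k by
      rw [← pow_add, Nat.sub_add_cancel hk']]
    field_simp
  have h32 : ¬ (p : ℤ) ∣ 32 ^ (n / 2) := by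
    rw [← CharP.intCast_eq_zero_iff K p]
    push_cast
    exact pow_ne_zero _ (by rw [show (32 : K) = 2 ^ 5 by norm_num]; exact pow_ne_zero _ h2)
  have conclude (c : ℤ) (h : (1 + s) ^ n + (1 - s) ^ n = 2 * (c : K)) :
      RatModEq p (∑ k ∈ Finset.range (p / 4 + 1),
        (Nat.choose (4 * k) (2 * k) : ℚ) * (1 / 32 ^ k)) c := by
    rw [hsum]
    refine ratModEq_div_of_dvd hp h32 ?_
    rw [← CharP.intCast_eq_zero_iff K p]
    push_cast
    apply mul_left_cancel₀ h2
    rw [mul_sub, key, h]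
    ring
  constructor
  · intro h
    have := conclude 1 (by rw [hpos (by simp only [Int.ModEq] at h; omega)]; norm_num)
    simpa using this
  · intro h
    have := conclude (-1) (by rw [hneg (by simp only [Int.ModEq] at h; omega)]; norm_num)
    simpa using this
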